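/- Let $K$ be a field of characteristic $0$, let $X$ be a smooth scheme over $K$, and write $\Omega=\Omega_{X/K}$. Let $\mathrm{D}^+(X)$ be the derived category of bounded below complexes of $\mathcal O_X$-modules. For an $\mathcal O_X$-module $E$ let $J_1(E)=p_{2*}(p_1^*E\otimes\mathcal O_{X\times_K X}/\mathcal I^2)$ be the sheaf of first jets, where $\mathcal I$ is the ideal of the diagonal; on an open affine $\operatorname{Spec}R$ on which $E$ is given by an $R$-module $M$ it is $M\otimes_R (R\otimes_K R)/I^2$, the tensor product being formed along the first factor of $R\otimes_K R$ and $R$ acting through the second factor. There is a functorial exact sequence $0\to E\otimes\Omega\xrightarrow{f}J_1(E)\xrightarrow{g}E\to 0$ with $f(m\otimes dr)=m\otimes[r\otimes 1-1\otimes r]$ and $g(m\otimes[a\otimes b])=abm$. A connection on $E$ is a $K$-linear morphism of sheaves $\nabla:E\to E\otimes\Omega$ with $\nabla(re)=r\nabla e+e\otimes dr$ for all local sections $r$ of $\mathcal O_X$ and $e$ of $E$. Let $E^\bullet$ be a bounded below complex of vector bundles (locally free $\mathcal O_X$-modules of finite rank) on $X$ with differential $d$. Let $E^\bullet\otimes\Omega[1]$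 be the complex with $E^{n+1}\otimes\Omega$ in degree $n$ and differential $d\otimes 1$ (without a sign), and let $\mathrm{Tot}=\mathrm{Tot}(E^\bullet\otimes\Omega\to J_1(E^\bullet))$ be the complex with $\mathrm{Tot}^n=J_1(E^n)\oplus (E^{n+1}\otimes\Omega)$ and differential $(x,y)\mapsto (dx+(-1)^nf(y),\,dy)$ on $\mathrm{Tot}^n$. The morphism of complexes $Q:\mathrm{Tot}\to E^\bullet$, $(x,y)\mapsto g(x)$, is a quasi-isomorphism, and $R:\mathrm{Tot}\to E^\bullet\otimes\Omega[1]$, $(x,y)\mapsto y$, is a morphism of complexes. The Atiyah class of $E^\bullet$ is $$\alpha(E^\bullet)=R\circ Q^{-1}\in\operatorname{Hom}_{\mathrm{D}^+(X)}(E^\bullet,E^\bullet\otimes\Omega[1]).$$ Suppose that every term $E^n$ has a global connection $\nabla_n:E^n\to E^n\otimes\Omega$. Then the maps $$\theta_n=(-1)^n\bigl(-\nabla_{n+1}\,d+(d\otimes 1)\nabla_n\bigr):E^n\to E^{n+1}\otimes\Omega$$ are $\mathcal O_X$-linear and form a morphism of complexes $\theta:E^\bullet\to E^\bullet\otimes\Omega[1]$,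 and $\alpha(E^\bullet)$ is the class of $\theta$ in $\operatorname{Hom}_{\mathrm{D}^+(X)}(E^\bullet,E^\bullet\otimes\Omega[1])$. -/

import Mathlib

open scoped TensorProduct

noncomputable section

section Ring
universe u
variable (k R : Type u) [CommRing k] [CommRing R] [Algebra k R]

/-- The ring `(R ⊗ₖ R) ⧸ I²`. -/
abbrev FirstOrder : Type u := (R ⊗[k] R) ⧸ (KaehlerDifferential.ideal k R) ^ 2

namespace FirstOrder

/-- The quotient map. -/
abbrev mk : R ⊗[k] R →ₐ[R] FirstOrder k R := Ideal.Quotient.mkₐ R _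

/-- The second inclusion `r ↦ [1 ⊗ r]`; the first one, `r ↦ [r ⊗ 1]`, is the `algebraMap`. -/
def right : R →+* FirstOrder k R :=
  (mk k R : R ⊗[k] R →+* FirstOrder k R).comp
    (Algebra.TensorProduct.includeRight : R →ₐ[k] R ⊗[k] R).toRingHom

lemma right_apply (r : R) : right k R r = mk k R (1 ⊗ₜ r) := rfl

lemma algebraMap_apply (r : R) : algebraMap R (FirstOrder k R) r = mk k R (r ⊗ₜ 1) := rfl

/-- The multiplication map `[a ⊗ b] ↦ a b`. -/
def mul : FirstOrder k R →ₐ[R] R :=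
  Ideal.Quotient.liftₐ _ (Algebra.TensorProduct.lmul'' k (S := R)) (by
    intro x hx
    have := Ideal.pow_le_self (two_ne_zero) hx
    exact this)

@[simp] lemma mul_right (r : R) : mul k R (right k R r) = r :=
  (one_mul r : (1 : R) * r = r)

/-- The inclusion `Ω = I ⧸ I² → (R ⊗ₖ R) ⧸ I²`, `d r ↦ [r ⊗ 1 - 1 ⊗ r]`. -/
def ofDifferential : Ω[R⁄k] →ₗ[R] FirstOrder k R :=
  -((KaehlerDifferential.ideal k R).cotangentToQuotientSquare.restrictScalars R)

lemma ofDifferential_toCotangent (x : KaehlerDifferential.ideal k R) :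
    ofDifferential k R ((KaehlerDifferential.ideal k R).toCotangent x) = - mk k R x := rfl

lemma ofDifferential_D (r : R) :
    ofDifferential k R (KaehlerDifferential.D k R r) = algebraMap R _ r - right k R r := by
  rw [KaehlerDifferential.D_apply, ofDifferential_toCotangent, right_apply, algebraMap_apply,
    ← map_neg, ← map_sub, neg_sub]

lemma right_mul_ofDifferential (r : R) (ω : Ω[R⁄k]) :
    right k R r * ofDifferential k R ω = ofDifferential k R (r • ω) := by
  rw [_root_.map_smul, Algebra.smul_def]
  obtain ⟨⟨x, hx⟩, rfl⟩ := Ideal.toCotangent_surjective _ ω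
  rw [ofDifferential_toCotangent, mul_neg, mul_neg, neg_inj, right_apply, algebraMap_apply,
    ← map_mul, ← map_mul]
  refine Ideal.Quotient.eq.2 ?_
  rw [← sub_mul, pow_two]
  exact Ideal.mul_mem_mul (KaehlerDifferential.one_smul_sub_smul_one_mem_ideal k r) hx

lemma mk_tmul (a b : R) : mk k R (a ⊗ₜ b) = right k R b * algebraMap R _ a := by
  rw [right_apply, algebraMap_apply, ← map_mul, Algebra.TensorProduct.tmul_mul_tmul, one_mul,
    mul_one]

variable {k R} in
lemma add_induction {P : FirstOrder k R → Prop} (h : ∀ a b, P (right k R a * algebraMap R _ b))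
    (hadd : ∀ x y, P x → P y → P (x + y)) (x) : P x := by
  obtain ⟨x, rfl⟩ := Ideal.Quotient.mk_surjective x
  induction x with
  | zero => simpa using h 0 0
  | tmul a b =>
    have := h b a
    rwa [← mk_tmul] at this
  | add x y hx hy => rw [map_add]; exact hadd _ _ hx hy

lemma tensorProductTo_eq_zero {x : R ⊗[k] R} (hx : x ∈ (KaehlerDifferential.ideal k R) ^ 2) :
    (KaehlerDifferential.D k R).tensorProductTo x = 0 := by
  rw [pow_two] at hx
  refine Submodule.mul_induction_on hx (fun x hx y hy => ?_) (fun x y hx hy => ?_)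
  · rw [Derivation.tensorProductTo_mul, (RingHom.mem_ker).1 hx, (RingHom.mem_ker).1 hy]
    simp
  · rw [map_add, hx, hy, add_zero]

/-- The `R`-linear projection `[a ⊗ b] ↦ - a db`. -/
def toDifferential : FirstOrder k R →ₗ[R] Ω[R⁄k] :=
  { QuotientAddGroup.lift ((KaehlerDifferential.ideal k R) ^ 2).toAddSubgroup
      (-(KaehlerDifferential.D k R).tensorProductTo.toAddMonoidHom)
      (fun x hx => neg_eq_zero.2 (tensorProductTo_eq_zero k R hx)) with
    map_smul' := by
      intro r x
      obtain ⟨x, rfl⟩ := Ideal.Quotient.mk_surjective x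
      change -(KaehlerDifferential.D k R).tensorProductTo (r • x) =
        r • -(KaehlerDifferential.D k R).tensorProductTo x
      rw [_root_.map_smul, smul_neg] }

lemma toDifferential_mk (x : R ⊗[k] R) :
    toDifferential k R (mk k R x) = -(KaehlerDifferential.D k R).tensorProductTo x := rfl

lemma toDifferential_apply (a b : R) :
    toDifferential k R (right k R a * algebraMap R _ b) = - (b • KaehlerDifferential.D k R a) := by
  rw [← mk_tmul, toDifferential_mk, Derivation.tensorProductTo_tmul]

lemma toDifferential_ofDifferential (ω : Ω[R⁄k]) :
    toDifferential k R (ofDifferential k R ω) = ω := by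
  obtain ⟨x, rfl⟩ := Ideal.toCotangent_surjective _ ω
  rw [ofDifferential_toCotangent, map_neg, toDifferential_mk, neg_neg,
    KaehlerDifferential.D_tensorProductTo]

lemma ofDifferential_toDifferential (x : FirstOrder k R) :
    algebraMap R _ (mul k R x) + ofDifferential k R (toDifferential k R x) = x := by
  induction x using add_induction with
  | h a b =>
    rw [toDifferential_apply, map_neg, _root_.map_smul, ofDifferential_D, map_mul,
      mul_right, AlgHom.commutes, Algebra.smul_def, map_mul, Algebra.algebraMap_self_apply]
    ring
  | hadd x y hx hy =>
    rw [map_add, map_add, map_add, map_add]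
    conv_rhs => rw [← hx, ← hy]
    exact add_add_add_comm _ _ _ _

lemma mul_ofDifferential (ω : Ω[R⁄k]) : mul k R (ofDifferential k R ω) = 0 := by
  obtain ⟨x, rfl⟩ := Ideal.toCotangent_surjective _ ω
  rw [ofDifferential_toCotangent, map_neg, neg_eq_zero]
  exact x.2

variable {k R} {R' R'' : Type u} [CommRing R'] [Algebra k R'] (σ : R →ₐ[k] R')
  [CommRing R''] [Algebra k R''] (τ : R' →ₐ[k] R'')

/-- The map induced by a morphism of algebras. -/
def map : FirstOrder k R →+* FirstOrder k R' :=
  Ideal.quotientMap _ (Algebra.TensorProduct.map σ σ).toRingHom (by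
    rw [← Ideal.map_le_iff_le_comap, Ideal.map_pow]
    refine Ideal.pow_right_mono (Ideal.map_le_iff_le_comap.2 ?_) 2
    intro x hx
    rw [Ideal.mem_comap, RingHom.mem_ker]
    have : ∀ x, Algebra.TensorProduct.lmul' k (S := R') (Algebra.TensorProduct.map σ σ x) =
      σ (Algebra.TensorProduct.lmul' k (S := R) x) := by
      intro x
      rw [← AlgHom.comp_apply, ← AlgHom.comp_apply]
      congr 1
      ext <;> simp
    have h2 : Algebra.TensorProduct.lmul' k (S := R) x = 0 := hx
    exact (this x).trans (by rw [h2, map_zero]))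

lemma map_mk (x : R ⊗[k] R) : map σ (mk k R x) = mk k R' (Algebra.TensorProduct.map σ σ x) := rfl

@[simp] lemma map_right (r : R) : map σ (right k R r) = right k R' (σ r) := by
  rw [right_apply, right_apply, map_mk, Algebra.TensorProduct.map_tmul, map_one]

@[simp] lemma map_algebraMap (r : R) : map σ (algebraMap R _ r) = algebraMap R' _ (σ r) := by
  rw [algebraMap_apply, algebraMap_apply, map_mk, Algebra.TensorProduct.map_tmul, map_one]

lemma map_smul (r : R) (x : FirstOrder k R) : map σ (r • x) = σ r • map σ x := by
  rw [Algebra.smul_def, Algebra.smul_def, map_mul, map_algebraMap]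

lemma mul_map (x : FirstOrder k R) : mul k R' (map σ x) = σ (mul k R x) := by
  induction x using add_induction with
  | h a b =>
    rw [map_mul, map_right, map_algebraMap, map_mul, map_mul, mul_right, mul_right,
      AlgHom.commutes, AlgHom.commutes, map_mul]
    rfl
  | hadd x y hx hy => rw [map_add, map_add, hx, hy, map_add, map_add]

lemma map_id_apply (x : FirstOrder k R) (σ : R →ₐ[k] R) (h : ∀ r, σ r = r) : map σ x = x := by
  induction x using add_induction with
  | h a b => simp [h]
  | hadd x y hx hy => rw [map_add, hx, hy]

lemma map_comp_apply (x : FirstOrder k R) (ρ : R →ₐ[k] R'') (h : ∀ r, ρ r = τ (σ r)) :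
    map ρ x = map τ (map σ x) := by
  induction x using add_induction with
  | h a b => simp [h]
  | hadd x y hx hy => rw [map_add, hx, hy, map_add, map_add]

end FirstOrder

/-- The module of first order jets `(R ⊗ₖ R) ⧸ I² ⊗_R M`: the tensor product is formed along the
first factor of `R ⊗ₖ R`, and `R` acts on the result through the second factor. On an affine
scheme `Spec R` this is `p₂_* (p₁^* M ⊗ 𝒪 ⧸ I²)`. -/
def Jet (M : Type u) [AddCommGroup M] [Module R M] : Type u := FirstOrder k R ⊗[R] M

namespace Jet

variable (M : Type u) [AddCommGroup M] [Module R M]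

instance : AddCommGroup (Jet k R M) := inferInstanceAs (AddCommGroup (FirstOrder k R ⊗[R] M))

instance : Module (FirstOrder k R) (Jet k R M) :=
  inferInstanceAs (Module (FirstOrder k R) (FirstOrder k R ⊗[R] M))

instance : Module R (Jet k R M) := Module.compHom _ (FirstOrder.right k R)

variable {M}

lemma smul_def (r : R) (x : Jet k R M) : r • x = FirstOrder.right k R r • x := rfl

/-- The universal first order operator `m ↦ [1 ⊗ 1] ⊗ m`. -/
def prolong : M →+ Jet k R M :=
  (TensorProduct.mk R (FirstOrder k R) M 1).toAddMonoidHom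

lemma prolong_smul (r : R) (m : M) :
    prolong k R (r • m) = algebraMap R (FirstOrder k R) r • prolong k R m := by
  change (1 : FirstOrder k R) ⊗ₜ[R] (r • m) = (algebraMap R (FirstOrder k R) r * 1) ⊗ₜ[R] m
  rw [← TensorProduct.smul_tmul, Algebra.smul_def]

variable {k R}

@[elab_as_elim]
lemma add_induction {P : Jet k R M → Prop} (h : ∀ (x : FirstOrder k R) m, P (x • prolong k R m))
    (hadd : ∀ x y, P x → P y → P (x + y)) (x) : P x := by
  have h0 : P 0 := by
    have := h 0 0
    rwa [zero_smul] at this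
  induction x using TensorProduct.induction_on with
  | zero => exact h0
  | tmul x m =>
    have := h x m
    have h : x • prolong k R m = ((x * 1) ⊗ₜ[R] m : FirstOrder k R ⊗[R] M) := rfl
    rwa [h, mul_one] at this
  | add x y hx hy => exact hadd _ _ hx hy

/-- The additive map out of `Jet` attached to a balanced biadditive map. -/
def lift {N : Type*} [AddCommGroup N] (b : FirstOrder k R →+ M →+ N)
    (hb : ∀ (r : R) x m, b (r • x) m = b x (r • m)) : Jet k R M →+ N :=
  TensorProduct.liftAddHom b hb

lemma lift_smul_prolong {N : Type*} [AddCommGroup N] (b : FirstOrder k R →+ M →+ N)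
    (hb : ∀ (r : R) x m, b (r • x) m = b x (r • m)) (x : FirstOrder k R) (m : M) :
    lift b hb (x • prolong k R m) = b x m :=
  congrArg (fun y => b y m) (mul_one x)

variable (k R M)

/-- The projection as an additive map. -/
def projAux : Jet k R M →+ M :=
  lift ((smulAddHom R M).comp (FirstOrder.mul k R).toLinearMap.toAddMonoidHom)
    (fun r x m => (congrArg (· • m) (_root_.map_smul (FirstOrder.mul k R) r x)).trans
      ((congrArg (· • m) (mul_comm _ _)).trans (mul_smul _ _ _)))

lemma projAux_smul_prolong (x : FirstOrder k R) (m : M) :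
    projAux k R M (x • prolong k R m) = FirstOrder.mul k R x • m :=
  lift_smul_prolong _ _ _ _

/-- The projection `J₁(M) → M`, `[a ⊗ b] ⊗ m ↦ a b m`. -/
def proj : Jet k R M →ₗ[R] M :=
  { projAux k R M with
    map_smul' := by
      intro r x
      change projAux k R M (r • x) = r • projAux k R M x
      induction x using add_induction with
      | h x m =>
        rw [smul_def, smul_smul, projAux_smul_prolong, projAux_smul_prolong, map_mul,
          FirstOrder.mul_right, mul_smul]
      | hadd x y hx hy => rw [smul_add, map_add, map_add, hx, hy, smul_add] }

lemma proj_smul_prolong (x : FirstOrder k R) (m : M) :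
    proj k R M (x • prolong k R m) = FirstOrder.mul k R x • m :=
  projAux_smul_prolong k R M x m

/-- The inclusion `M ⊗ Ω → J₁(M)`, `m ⊗ dr ↦ [r ⊗ 1 - 1 ⊗ r] ⊗ m`. -/
def incl : M ⊗[R] Ω[R⁄k] →ₗ[R] Jet k R M :=
  TensorProduct.lift
  { toFun m :=
      { toFun ω := FirstOrder.ofDifferential k R ω • prolong k R m
        map_add' := by simp [add_smul]
        map_smul' := by intro r x; rw [← FirstOrder.right_mul_ofDifferential, mul_smul]; rfl }
    map_add' := by intro x y; ext; simp
    map_smul' := by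
      intro r x
      ext ω
      simp only [LinearMap.coe_mk, AddHom.coe_mk, prolong_smul, LinearMap.smul_apply,
        RingHom.id_apply, smul_def, smul_smul, FirstOrder.right_mul_ofDifferential]
      rw [_root_.map_smul, Algebra.smul_def, mul_comm] }

lemma incl_tmul (m : M) (ω : Ω[R⁄k]) :
    incl k R M (m ⊗ₜ ω) = FirstOrder.ofDifferential k R ω • prolong k R m := rfl

lemma incl_tmul_D (m : M) (r : R) :
    incl k R M (m ⊗ₜ KaehlerDifferential.D k R r) = prolong k R (r • m) - r • prolong k R m := by
  rw [incl_tmul, FirstOrder.ofDifferential_D, sub_smul, prolong_smul]; rfl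

/-- An additive retraction of `incl`. -/
def retr : Jet k R M →+ M ⊗[R] Ω[R⁄k] :=
  lift { toFun x := (((TensorProduct.mk R M Ω[R⁄k]).flip (FirstOrder.toDifferential k R x)).toAddMonoidHom)
         map_zero' := by ext; simp
         map_add' x y := by ext; simp }
    (fun r x m => by simp)

lemma retr_smul_prolong (x : FirstOrder k R) (m : M) :
    retr k R M (x • prolong k R m) = m ⊗ₜ FirstOrder.toDifferential k R x :=
  lift_smul_prolong _ _ _ _

lemma retr_incl (x : M ⊗[R] Ω[R⁄k]) : retr k R M (incl k R M x) = x := by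
  induction x using TensorProduct.induction_on with
  | zero => simp
  | tmul m x => rw [incl_tmul, retr_smul_prolong, FirstOrder.toDifferential_ofDifferential]
  | add x y hx hy => simp only [map_add, hx, hy]

lemma incl_retr (x : Jet k R M) :
    prolong k R (proj k R M x) + incl k R M (retr k R M x) = x := by
  induction x using add_induction with
  | h x m =>
    rw [proj_smul_prolong, retr_smul_prolong, incl_tmul, prolong_smul, ← add_smul,
      FirstOrder.ofDifferential_toDifferential]
  | hadd x y hx hy =>
    rw [map_add, map_add, map_add, map_add]
    conv_rhs => rw [← hx, ← hy]
    exact add_add_add_comm _ _ _ _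

lemma proj_prolong (m : M) : proj k R M (prolong k R m) = m := by
  have := proj_smul_prolong k R M 1 m
  rwa [one_smul, map_one, one_smul] at this

lemma proj_incl (x : M ⊗[R] Ω[R⁄k]) : proj k R M (incl k R M x) = 0 := by
  induction x using TensorProduct.induction_on with
  | zero => simp
  | tmul m x => rw [incl_tmul, proj_smul_prolong, FirstOrder.mul_ofDifferential, zero_smul]
  | add x y hx hy => rw [map_add, map_add, hx, hy, add_zero]

variable {k R M} {R' R'' : Type u} [CommRing R'] [Algebra k R'] (σ : R →ₐ[k] R')
  {M' : Type u} [AddCommGroup M'] [Module R' M']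

/-- The additive map induced by a semilinear map. -/
def map (ψ : M →+ M') (hψ : ∀ (r : R) m, ψ (r • m) = σ r • ψ m) : Jet k R M →+ Jet k R' M' :=
  lift { toFun x := (DistribSMul.toAddMonoidHom (Jet k R' M') (FirstOrder.map σ x)).comp
          ((prolong k R').comp ψ)
         map_zero' := by ext; simp
         map_add' x y := by ext; simp [add_smul] }
    (fun r x m => by
      simp [Algebra.smul_def, hψ, prolong_smul, smul_smul, mul_comm])

lemma map_smul_prolong (ψ : M →+ M') (hψ : ∀ (r : R) m, ψ (r • m) = σ r • ψ m)
    (x : FirstOrder k R) (m : M) :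
    map σ ψ hψ (x • prolong k R m) = FirstOrder.map σ x • prolong k R' (ψ m) :=
  lift_smul_prolong _ _ _ _

lemma map_smul (ψ : M →+ M') (hψ : ∀ (r : R) m, ψ (r • m) = σ r • ψ m) (r : R) (x : Jet k R M) :
    map σ ψ hψ (r • x) = σ r • map σ ψ hψ x := by
  induction x using add_induction with
  | h x m =>
    simp only [smul_def, smul_smul, map_smul_prolong, map_mul, FirstOrder.map_right]
  | hadd x y hx hy =>
    rw [smul_add, map_add, hx, hy, map_add, smul_add]

variable [CommRing R''] [Algebra k R''] (τ : R' →ₐ[k] R'')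
  {M'' : Type u} [AddCommGroup M''] [Module R'' M'']

lemma map_id_apply (σ : R →ₐ[k] R) (hσ : ∀ r, σ r = r) (ψ : M →+ M)
    (hψ : ∀ (r : R) m, ψ (r • m) = σ r • ψ m) (h : ∀ m, ψ m = m) (x : Jet k R M) :
    map σ ψ hψ x = x := by
  induction x using add_induction with
  | h x m => rw [map_smul_prolong, h, FirstOrder.map_id_apply _ _ hσ]
  | hadd x y hx hy => rw [map_add, hx, hy]

lemma map_comp_apply (ψ : M →+ M') (hψ : ∀ (r : R) m, ψ (r • m) = σ r • ψ m)
    (ψ' : M' →+ M'') (hψ' : ∀ (r : R') m, ψ' (r • m) = τ r • ψ' m)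
    (ρ : R →ₐ[k] R'') (hρ : ∀ r, ρ r = τ (σ r)) (χ : M →+ M'')
    (hχ : ∀ (r : R) m, χ (r • m) = ρ r • χ m) (h : ∀ m, χ m = ψ' (ψ m)) (x : Jet k R M) :
    map ρ χ hχ x = map τ ψ' hψ' (map σ ψ hψ x) := by
  induction x using add_induction with
  | h x m =>
    rw [map_smul_prolong, map_smul_prolong, map_smul_prolong, h,
      FirstOrder.map_comp_apply σ τ x ρ hρ]
  | hadd x y hx hy => rw [map_add, hx, hy, map_add, map_add]

lemma proj_map (ψ : M →+ M') (hψ : ∀ (r : R) m, ψ (r • m) = σ r • ψ m) (x : Jet k R M) :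
    proj k R' M' (map σ ψ hψ x) = ψ (proj k R M x) := by
  induction x using add_induction with
  | h x m =>
    rw [map_smul_prolong, proj_smul_prolong, proj_smul_prolong, hψ, FirstOrder.mul_map]
  | hadd x y hx hy => rw [map_add, map_add, map_add, map_add, hx, hy]

lemma map_incl_tmul_D (ψ : M →+ M') (hψ : ∀ (r : R) m, ψ (r • m) = σ r • ψ m) (m : M) (r : R) :
    map σ ψ hψ (incl k R M (m ⊗ₜ KaehlerDifferential.D k R r)) =
      incl k R' M' (ψ m ⊗ₜ KaehlerDifferential.D k R' (σ r)) := by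
  rw [incl_tmul, incl_tmul, map_smul_prolong, FirstOrder.ofDifferential_D,
    FirstOrder.ofDifferential_D, map_sub, FirstOrder.map_algebraMap, FirstOrder.map_right]

lemma map_prolong (ψ : M →+ M') (hψ : ∀ (r : R) m, ψ (r • m) = σ r • ψ m) (m : M) :
    map σ ψ hψ (prolong k R m) = prolong k R' (ψ m) := by
  have := map_smul_prolong σ ψ hψ 1 m
  rwa [one_smul, map_one, one_smul] at this

lemma map_add_apply (ψ : M →+ M') (hψ : ∀ (r : R) m, ψ (r • m) = σ r • ψ m)
    (ψ' : M →+ M') (hψ' : ∀ (r : R) m, ψ' (r • m) = σ r • ψ' m)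
    (χ : M →+ M') (hχ : ∀ (r : R) m, χ (r • m) = σ r • χ m) (h : ∀ m, χ m = ψ m + ψ' m)
    (x : Jet k R M) : map σ χ hχ x = map σ ψ hψ x + map σ ψ' hψ' x := by
  induction x using add_induction with
  | h x m => rw [map_smul_prolong, map_smul_prolong, map_smul_prolong, h, map_add, smul_add]
  | hadd x y hx hy => rw [map_add, map_add, map_add, hx, hy, add_add_add_comm]

/-- An additive induction principle. -/
lemma tensor_induction {P : M ⊗[R] Ω[R⁄k] → Prop}
    (h : ∀ m (r : R), P (m ⊗ₜ KaehlerDifferential.D k R r))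
    (hadd : ∀ x y, P x → P y → P (x + y)) (x : M ⊗[R] Ω[R⁄k]) : P x := by
  have h0 : P 0 := by simpa using h 0 0
  induction x using TensorProduct.induction_on with
  | zero => exact h0
  | tmul m ω =>
    have := KaehlerDifferential.span_range_derivation k R
    have hω : ω ∈ Submodule.span R (Set.range (KaehlerDifferential.D k R)) := by
      rw [this]; trivial
    induction hω using Submodule.span_induction generalizing m with
    | mem x hx => obtain ⟨r, rfl⟩ := hx; exact h m r
    | zero => simpa using h0
    | add x y _ _ hx hy => rw [TensorProduct.tmul_add]; exact hadd _ _ (hx m) (hy m)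
    | smul a x _ hx => rw [TensorProduct.tmul_smul, TensorProduct.smul_tmul']; exact hx _
  | add x y hx hy => exact hadd _ _ hx hy

end Jet
end Ring
section Presheaf
open CategoryTheory MonoidalCategory
universe u v w
variable {C : Type w} [Category.{v} C] {A : CommRingCat.{u}} {R : Cᵒᵖ ⥤ CommRingCat.{u}}
  (φ : (Functor.const Cᵒᵖ).obj A ⟶ R)

/-! Sections over `U` of the presheaves `M ⊗ Ω` and `J₁(M)`, for a presheaf of modules `M` over a
presheaf of commutative `A`-algebras `R`, are `M(U) ⊗ Ω_{R(U)/A}` and `J₁(M(U))`. -/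

namespace PresheafJet

/-- The `A`-algebra structure on `R(U)`. -/
abbrev algebra (U : Cᵒᵖ) : Algebra A (R.obj U) := (φ.app U).hom.toAlgebra

def algHom {U V : Cᵒᵖ} (i : U ⟶ V) :
    letI := algebra φ U
    letI := algebra φ V
    R.obj U →ₐ[A] R.obj V :=
  letI := algebra φ U
  letI := algebra φ V
  { (R.map i).hom with
    commutes' a := by
      have := φ.naturality i
      exact (congrArg (fun f => f.hom a) this).symm }

open PresheafOfModules

variable {M N P : PresheafOfModules.{u} (R ⋙ forget₂ CommRingCat RingCat)}

variable (M) in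
/-- The sections of `M` over `U`. -/
def sec (U : Cᵒᵖ) : Type u := M.obj U

instance (U : Cᵒᵖ) : AddCommGroup (sec M U) := inferInstanceAs (AddCommGroup (M.obj U))
instance (U : Cᵒᵖ) : Module (R.obj U) (sec M U) :=
  inferInstanceAs (Module ((R ⋙ forget₂ CommRingCat RingCat).obj U) (M.obj U))

variable (M) in
def res {U V : Cᵒᵖ} (i : U ⟶ V) : sec M U →+ sec M V := (M.map i).hom.toAddMonoidHom

lemma res_smul {U V : Cᵒᵖ} (i : U ⟶ V) (r : R.obj U) (m : sec M U) :
    res M i (r • m) = R.map i r • res M i m := M.map_smul i r m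

lemma res_id (U : Cᵒᵖ) (m : sec M U) : res M (𝟙 U) m = m :=
  congrArg (fun f => f.hom m) (M.map_id U)

lemma res_comp {U V W : Cᵒᵖ} (i : U ⟶ V) (j : V ⟶ W) (m : sec M U) :
    res M (i ≫ j) m = res M j (res M i m) :=
  congrArg (fun f => f.hom m) (M.map_comp i j)

def ev (f : M ⟶ N) (U : Cᵒᵖ) : sec M U →ₗ[R.obj U] sec N U := (f.app U).hom

lemma ev_res (f : M ⟶ N) {U V : Cᵒᵖ} (i : U ⟶ V) (m : sec M U) :
    ev f V (res M i m) = res N i (ev f U m) :=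
  congrArg (fun f => f.hom m) (f.naturality i)

lemma ev_id (U : Cᵒᵖ) (m : sec M U) : ev (𝟙 M) U m = m := rfl
lemma ev_comp (f : M ⟶ N) (g : N ⟶ P) (U : Cᵒᵖ) (m : sec M U) :
    ev (f ≫ g) U m = ev g U (ev f U m) := rfl

variable (M) in
abbrev JetSec (U : Cᵒᵖ) : Type u :=
  letI := algebra φ U
  Jet A (R.obj U) (sec M U)

variable (M) in
def jetMap {U V : Cᵒᵖ} (i : U ⟶ V) : JetSec φ M U →+ JetSec φ M V :=
  letI := algebra φ U
  letI := algebra φ V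
  Jet.map (algHom φ i) (res M i) (res_smul i)

lemma jetMap_smul {U V : Cᵒᵖ} (i : U ⟶ V) (r : R.obj U) (x : JetSec φ M U) :
    jetMap φ M i (r • x) = R.map i r • jetMap φ M i x :=
  letI := algebra φ U
  letI := algebra φ V
  Jet.map_smul (algHom φ i) (res M i) (res_smul i) r x

lemma jetMap_id (U : Cᵒᵖ) (x : JetSec φ M U) : jetMap φ M (𝟙 U) x = x :=
  letI := algebra φ U
  Jet.map_id_apply (algHom φ (𝟙 U)) (fun r => congrArg (fun f => f.hom r) (R.map_id U)) _ _
    (res_id U) x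

lemma jetMap_comp {U V W : Cᵒᵖ} (i : U ⟶ V) (j : V ⟶ W) (x : JetSec φ M U) :
    jetMap φ M (i ≫ j) x = jetMap φ M j (jetMap φ M i x) :=
  letI := algebra φ U
  letI := algebra φ V
  letI := algebra φ W
  Jet.map_comp_apply (algHom φ i) (algHom φ j) _ _ _ _ (algHom φ (i ≫ j))
    (fun r => congrArg (fun f => f.hom r) (R.map_comp i j)) _ _ (res_comp i j) x

def jetEv (f : M ⟶ N) (U : Cᵒᵖ) : JetSec φ M U →ₗ[R.obj U] JetSec φ N U :=
  letI := algebra φ U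
  { Jet.map (AlgHom.id A (R.obj U)) (ev f U).toAddMonoidHom (ev f U).map_smul with
    map_smul' := Jet.map_smul (AlgHom.id A (R.obj U)) _ _ }

lemma jetEv_jetMap (f : M ⟶ N) {U V : Cᵒᵖ} (i : U ⟶ V) (x : JetSec φ M U) :
    jetEv φ f V (jetMap φ M i x) = jetMap φ N i (jetEv φ f U x) := by
  let := algebra φ U
  let := algebra φ V
  have h : ∀ (r : R.obj U) (m : sec M U), ((ev f V).toAddMonoidHom.comp (res M i)) (r • m) =
      algHom φ i r • ((ev f V).toAddMonoidHom.comp (res M i)) m := fun r m =>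
    (congrArg (ev f V) (res_smul i r m)).trans ((ev f V).map_smul _ _)
  exact (Jet.map_comp_apply (algHom φ i) (AlgHom.id A (R.obj V)) (res M i) (res_smul i)
    (ev f V).toAddMonoidHom (ev f V).map_smul (algHom φ i) (fun _ => rfl) _ h
    (fun _ => rfl) x).symm.trans
    (Jet.map_comp_apply (AlgHom.id A (R.obj U)) (algHom φ i) (ev f U).toAddMonoidHom
      (ev f U).map_smul (res N i) (res_smul i) (algHom φ i) (fun _ => rfl) _ h (ev_res f i) x)

lemma jetEv_id (U : Cᵒᵖ) (x : JetSec φ M U) : jetEv φ (𝟙 M) U x = x :=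
  letI := algebra φ U
  Jet.map_id_apply (AlgHom.id A (R.obj U)) (fun _ => rfl) (ev (𝟙 M) U).toAddMonoidHom
    (ev (𝟙 M) U).map_smul (ev_id U) x

lemma jetEv_comp (f : M ⟶ N) (g : N ⟶ P) (U : Cᵒᵖ) (x : JetSec φ M U) :
    jetEv φ (f ≫ g) U x = jetEv φ g U (jetEv φ f U x) :=
  letI := algebra φ U
  Jet.map_comp_apply (AlgHom.id A (R.obj U)) (AlgHom.id A (R.obj U)) (ev f U).toAddMonoidHom
    (ev f U).map_smul (ev g U).toAddMonoidHom (ev g U).map_smul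
    (AlgHom.id A (R.obj U)) (fun _ => rfl) (ev (f ≫ g) U).toAddMonoidHom (ev (f ≫ g) U).map_smul
    (ev_comp f g U) x

variable (M) in
def jetAb : Cᵒᵖ ⥤ Ab.{u} where
  obj U := AddCommGrpCat.of (JetSec φ M U)
  map i := AddCommGrpCat.ofHom (jetMap φ M i)
  map_id U := by ext x; exact jetMap_id φ U x
  map_comp i j := by ext x; exact jetMap_comp φ i j x

instance (U : Cᵒᵖ) : Module ((R ⋙ forget₂ CommRingCat RingCat).obj U) ((jetAb φ M).obj U) :=
  inferInstanceAs (Module (R.obj U) (JetSec φ M U))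

variable (M) in
def jetObj : PresheafOfModules.{u} (R ⋙ forget₂ CommRingCat RingCat) :=
  ofPresheaf (jetAb φ M) (fun _ _ i r x => jetMap_smul φ i r x)

def jetHom (f : M ⟶ N) : jetObj φ M ⟶ jetObj φ N :=
  homMk { app U := AddCommGrpCat.ofHom (jetEv φ f U).toAddMonoidHom
          naturality U V i := by ext x; exact jetEv_jetMap φ f i x }
    (fun U r x => (jetEv φ f U).map_smul r x)

/-- The functor `M ↦ J₁(M)` on presheaves of modules. -/
def jet : PresheafOfModules.{u} (R ⋙ forget₂ CommRingCat RingCat) ⥤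
    PresheafOfModules.{u} (R ⋙ forget₂ CommRingCat RingCat) where
  obj M := jetObj φ M
  map f := jetHom φ f
  map_id M := by ext U x; exact jetEv_id φ U x
  map_comp f g := by ext U x; exact jetEv_comp φ f g U x

/-- The functor `M ↦ M ⊗ Ω` on presheaves of modules. -/
def twist : PresheafOfModules.{u} (R ⋙ forget₂ CommRingCat RingCat) ⥤
    PresheafOfModules.{u} (R ⋙ forget₂ CommRingCat RingCat) :=
  tensorRight (DifferentialsConstruction.relativeDifferentials' φ)

variable (M) in
def projEv (U : Cᵒᵖ) : JetSec φ M U →ₗ[R.obj U] sec M U :=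
  letI := algebra φ U
  Jet.proj A (R.obj U) (sec M U)

lemma projEv_jetMap {U V : Cᵒᵖ} (i : U ⟶ V) (x : JetSec φ M U) :
    projEv φ M V (jetMap φ M i x) = res M i (projEv φ M U x) :=
  letI := algebra φ U
  letI := algebra φ V
  Jet.proj_map (algHom φ i) (res M i) (res_smul i) x

lemma projEv_jetEv (f : M ⟶ N) (U : Cᵒᵖ) (x : JetSec φ M U) :
    projEv φ N U (jetEv φ f U x) = ev f U (projEv φ M U x) :=
  letI := algebra φ U
  Jet.proj_map (AlgHom.id A (R.obj U)) (ev f U).toAddMonoidHom (ev f U).map_smul x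

variable (M) in
def projApp : jetObj φ M ⟶ M :=
  homMk { app U := AddCommGrpCat.ofHom (projEv φ M U).toAddMonoidHom
          naturality U V i := by ext x; exact projEv_jetMap φ i x }
    (fun U r x => (projEv φ M U).map_smul r x)

/-- The projection `J₁(M) ⟶ M`. -/
def proj : jet φ ⟶ 𝟭 _ where
  app M := projApp φ M
  naturality M N f := by ext U x; exact projEv_jetEv φ f U x

variable (M) in
abbrev TwistSec (U : Cᵒᵖ) : Type u :=
  letI := algebra φ U
  sec M U ⊗[R.obj U] Ω[R.obj U⁄A]

variable {φ} in
/-- The section `m ⊗ dr`. -/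
def tmulD {U : Cᵒᵖ} (m : sec M U) (r : R.obj U) : TwistSec φ M U :=
  letI := algebra φ U
  m ⊗ₜ KaehlerDifferential.D A (R.obj U) r

def twistMap {U V : Cᵒᵖ} (i : U ⟶ V) : TwistSec φ M U →+ TwistSec φ M V :=
  (((twist φ).obj M).map i).hom.toAddMonoidHom

lemma twistMap_tmulD {U V : Cᵒᵖ} (i : U ⟶ V) (m : sec M U) (r : R.obj U) :
    twistMap φ i (tmulD m r) = tmulD (res M i m) (R.map i r) :=
  letI := algebra φ V
  congrArg (fun ω => (res M i m) ⊗ₜ[R.obj V] ω)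
    (DifferentialsConstruction.relativeDifferentials'_map_d φ i r)

def twistEv (f : M ⟶ N) (U : Cᵒᵖ) : TwistSec φ M U →+ TwistSec φ N U :=
  (((twist φ).map f).app U).hom.toAddMonoidHom

lemma twistEv_tmulD (f : M ⟶ N) (U : Cᵒᵖ) (m : sec M U) (r : R.obj U) :
    twistEv φ f U (tmulD m r) = tmulD (ev f U m) r := rfl

variable (M) in
def inclEv (U : Cᵒᵖ) : TwistSec φ M U →ₗ[R.obj U] JetSec φ M U :=
  letI := algebra φ U
  Jet.incl A (R.obj U) (sec M U)

lemma twist_hom_ext {T : Type*} [AddCommGroup T] {U : Cᵒᵖ} {f g : TwistSec φ M U →+ T}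
    (h : ∀ m r, f (tmulD m r) = g (tmulD m r)) (x : TwistSec φ M U) : f x = g x := by
  let := algebra φ U
  induction x using Jet.tensor_induction with
  | h m r => exact h m r
  | hadd x y hx hy => rw [map_add, map_add, hx, hy]

lemma inclEv_twistMap {U V : Cᵒᵖ} (i : U ⟶ V) (x : TwistSec φ M U) :
    inclEv φ M V (twistMap φ i x) = jetMap φ M i (inclEv φ M U x) := by
  let := algebra φ U
  let := algebra φ V
  refine twist_hom_ext φ (f := (inclEv φ M V).toAddMonoidHom.comp (twistMap φ i))
    (g := (jetMap φ M i).comp (inclEv φ M U).toAddMonoidHom) (fun m r => ?_) x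
  exact (congrArg (inclEv φ M V) (twistMap_tmulD φ i m r)).trans
    (Jet.map_incl_tmul_D (algHom φ i) (res M i) (res_smul i) m r).symm

lemma inclEv_twistEv (f : M ⟶ N) (U : Cᵒᵖ) (x : TwistSec φ M U) :
    inclEv φ N U (twistEv φ f U x) = jetEv φ f U (inclEv φ M U x) := by
  let := algebra φ U
  refine twist_hom_ext φ (f := (inclEv φ N U).toAddMonoidHom.comp (twistEv φ f U))
    (g := (jetEv φ f U).toAddMonoidHom.comp (inclEv φ M U).toAddMonoidHom) (fun m r => ?_) x
  exact (Jet.map_incl_tmul_D (AlgHom.id A (R.obj U)) (ev f U).toAddMonoidHom (ev f U).map_smul m r).symm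

variable (M) in
def inclApp : (twist φ).obj M ⟶ jetObj φ M :=
  homMk { app U := AddCommGrpCat.ofHom (inclEv φ M U).toAddMonoidHom
          naturality U V i := by ext x; exact inclEv_twistMap φ i x }
    (fun U r x => (inclEv φ M U).map_smul r x)

/-- The inclusion `M ⊗ Ω ⟶ J₁(M)`. -/
def incl : twist φ ⟶ jet φ where
  app M := inclApp φ M
  naturality M N f := by ext U x; exact inclEv_twistEv φ f U x

instance : (twist φ).Additive where
  map_add {M N f g} := by
    ext U x
    refine twist_hom_ext φ (f := twistEv φ (f + g) U) (g := twistEv φ f U + twistEv φ g U)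
      (fun m r => ?_) x
    let := algebra φ U
    exact TensorProduct.add_tmul (R := R.obj U) (ev f U m) (ev g U m)
      (KaehlerDifferential.D A (R.obj U) r)

instance : (jet φ).Additive where
  map_add {M N f g} := by
    ext U x
    let := algebra φ U
    exact Jet.map_add_apply (AlgHom.id A (R.obj U)) (ev f U).toAddMonoidHom (ev f U).map_smul
      (ev g U).toAddMonoidHom (ev g U).map_smul (ev (f + g) U).toAddMonoidHom
      (ev (f + g) U).map_smul (fun _ => rfl) x

lemma incl_comp_proj : (incl φ).app M ≫ (proj φ).app M = 0 := by
  ext U x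
  let := algebra φ U
  exact Jet.proj_incl A (R.obj U) (sec M U) x

variable (M) in
abbrev shortComplex : ShortComplex (PresheafOfModules.{u} (R ⋙ forget₂ CommRingCat RingCat)) :=
  ShortComplex.mk ((incl φ).app M) ((proj φ).app M) (incl_comp_proj φ)

variable (M) in
/-- The universal first order operator. -/
def prolong (U : Cᵒᵖ) : sec M U →+ JetSec φ M U :=
  letI := algebra φ U
  Jet.prolong A (R.obj U)

lemma prolong_res {U V : Cᵒᵖ} (i : U ⟶ V) (m : sec M U) :
    prolong φ M V (res M i m) = jetMap φ M i (prolong φ M U m) := by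
  let := algebra φ U
  let := algebra φ V
  exact (Jet.map_prolong (algHom φ i) (res M i) (res_smul i) m).symm

variable (M) in
def retr (U : Cᵒᵖ) : JetSec φ M U →+ TwistSec φ M U :=
  letI := algebra φ U
  Jet.retr A (R.obj U) (sec M U)

lemma retr_inclEv (U : Cᵒᵖ) (x : TwistSec φ M U) : retr φ M U (inclEv φ M U x) = x :=
  letI := algebra φ U
  Jet.retr_incl A (R.obj U) (sec M U) x

lemma inclEv_retr (U : Cᵒᵖ) (x : JetSec φ M U) :
    prolong φ M U (projEv φ M U x) + inclEv φ M U (retr φ M U x) = x :=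
  letI := algebra φ U
  Jet.incl_retr A (R.obj U) (sec M U) x

lemma projEv_prolong (U : Cᵒᵖ) (m : sec M U) : projEv φ M U (prolong φ M U m) = m :=
  letI := algebra φ U
  Jet.proj_prolong A (R.obj U) (sec M U) m

lemma retr_jetMap {U V : Cᵒᵖ} (i : U ⟶ V) (x : JetSec φ M U) :
    retr φ M V (jetMap φ M i x) = twistMap φ i (retr φ M U x) := by
  have h := inclEv_retr φ U x
  have h1 := congrArg (retr φ M V) (congrArg (jetMap φ M i) h)
  have h2 := inclEv_retr φ V (jetMap φ M i x)
  have hinj : Function.Injective (inclEv φ M V) :=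
    Function.LeftInverse.injective (retr_inclEv φ V)
  apply hinj
  rw [inclEv_twistMap]
  have h3 : jetMap φ M i x = prolong φ M V (projEv φ M V (jetMap φ M i x)) +
      jetMap φ M i (inclEv φ M U (retr φ M U x)) := by
    rw [projEv_jetMap, prolong_res, ← map_add, h]
  exact add_left_cancel (h2.trans h3)

lemma shortExact : (shortComplex φ M).ShortExact := by
  let F := PresheafOfModules.toPresheaf.{u} (R ⋙ forget₂ CommRingCat RingCat)
  let σ : ((shortComplex φ M).map F).Splitting :=
    { r := { app U := AddCommGrpCat.ofHom (retr φ M U)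
             naturality U V i := by ext x; exact retr_jetMap φ i x }
      s := { app U := AddCommGrpCat.ofHom (prolong φ M U)
             naturality U V i := by ext x; exact prolong_res φ i x }
      f_r := by ext U x; exact retr_inclEv φ U x
      s_g := by ext U x; exact projEv_prolong φ U x
      id := by ext U x; exact (add_comm _ _).trans (inclEv_retr φ U x) }
  have h := σ.shortExact
  have : Mono (F.map ((incl φ).app M)) := h.mono_f
  have : Epi (F.map ((proj φ).app M)) := h.epi_g
  exact { exact := ((shortComplex φ M).exact_map_iff_of_faithful F).1 h.exact
          mono_f := F.mono_of_mono_map inferInstance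
          epi_g := F.epi_of_epi_map inferInstance }

end PresheafJet

end Presheaf
section Sheaf
open CategoryTheory AlgebraicGeometry
universe u
variable {k : Type u} [CommRing k] {X : Scheme.{u}} (f : X ⟶ Spec (CommRingCat.of k))

namespace AtiyahClass

/-- The structure morphism `k ⟶ 𝒪_X`, as a morphism of presheaves of rings. -/
def scalars : (Functor.const _).obj (CommRingCat.of k) ⟶ X.presheaf where
  app U := (Scheme.ΓSpecIso (CommRingCat.of k)).inv ≫ f.appTop ≫ X.presheaf.map (homOfLE le_top).op
  naturality U V i := by
    simp only [Functor.const_obj_obj, Functor.const_obj_map, Category.id_comp, Category.assoc]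
    rw [← Functor.map_comp]
    rfl

variable (X) in
/-- Presheaves of `𝒪_X`-modules. -/
abbrev PMod : Type (u + 1) := PresheafOfModules.{u} (X.presheaf ⋙ forget₂ CommRingCat RingCat)

variable (X) in
/-- Sheafification. -/
def sheafify : PMod X ⥤ X.Modules :=
  (PresheafOfModules.sheafification (𝟙 X.ringCatSheaf.obj) :
    X.PresheafOfModules ⥤ SheafOfModules X.ringCatSheaf)

variable (X) in
/-- The underlying presheaf. -/
def forget : X.Modules ⥤ PMod X := Scheme.Modules.toPresheafOfModules X

variable (X) in
/-- Sheafification is left adjoint to the underlying presheaf. -/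
def adj : sheafify X ⊣ forget X :=
  PresheafOfModules.sheafificationAdjunction (𝟙 X.ringCatSheaf.obj)

instance : IsIso (adj X).counit :=
  inferInstanceAs (IsIso (PresheafOfModules.sheafificationAdjunction (𝟙 X.ringCatSheaf.obj)).counit)

/-- The functor `E ↦ E ⊗ Ω_{X/k}`: the sheaf associated with `U ↦ E(U) ⊗ Ω_{𝒪(U)/k}`. -/
def twist : X.Modules ⥤ X.Modules := forget X ⋙ PresheafJet.twist (scalars f) ⋙ sheafify X

/-- The functor `E ↦ J₁(E)`: the sheaf associated with `U ↦ J₁(E(U))`. -/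
def jet : X.Modules ⥤ X.Modules := forget X ⋙ PresheafJet.jet (scalars f) ⋙ sheafify X

/-- The inclusion `E ⊗ Ω_{X/k} ⟶ J₁(E)`. -/
def incl : twist f ⟶ jet f :=
  Functor.whiskerLeft (forget X) (Functor.whiskerRight (PresheafJet.incl (scalars f)) (sheafify X))

/-- The projection `J₁(E) ⟶ E`. -/
def proj : jet f ⟶ 𝟭 X.Modules :=
  Functor.whiskerLeft (forget X) (Functor.whiskerRight (PresheafJet.proj (scalars f)) (sheafify X))
   ≫ (adj X).counit

instance : (forget X).Additive where
instance : (sheafify X).Additive := (adj X).left_adjoint_additive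
instance : (twist f).Additive := by unfold twist; infer_instance
instance : (jet f).Additive := by unfold jet; infer_instance
instance : Limits.PreservesFiniteLimits (sheafify X) :=
  inferInstanceAs (Limits.PreservesFiniteLimits
    (PresheafOfModules.sheafification (𝟙 X.ringCatSheaf.obj)))
instance : Limits.PreservesFiniteColimits (sheafify X) := by
  have := (adj X).leftAdjoint_preservesColimits
  infer_instance

lemma incl_comp_proj (E : X.Modules) : (incl f).app E ≫ (proj f).app E = 0 := by
  have h := PresheafJet.incl_comp_proj (scalars f) (M := (forget X).obj E)
  have h' := (((sheafify X).map_comp _ _).symm.trans (congrArg (sheafify X).map h)).trans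
    (Functor.map_zero _ _ _)
  exact (Category.assoc _ _ _).symm.trans ((congrArg (· ≫ (adj X).counit.app E) h').trans
    Limits.zero_comp)

lemma shortExact (E : X.Modules) :
    (ShortComplex.mk ((incl f).app E) ((proj f).app E) (incl_comp_proj f E)).ShortExact := by
  have h := (PresheafJet.shortExact (scalars f) (M := (forget X).obj E)).map_of_exact (sheafify X)
  refine ShortComplex.shortExact_of_iso (S₂ := ShortComplex.mk ((incl f).app E) ((proj f).app E)
    (incl_comp_proj f E)) ?_ h
  exact ShortComplex.isoMk (S₁ := (PresheafJet.shortComplex (scalars f)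
    ((forget X).obj E)).map (sheafify X)) (S₂ := ShortComplex.mk ((incl f).app E) ((proj f).app E)
    (incl_comp_proj f E)) (Iso.refl ((twist f).obj E)) (Iso.refl ((jet f).obj E))
    ((asIso (adj X).counit).app E) ((Category.id_comp _).trans (Category.comp_id _).symm)
    (Category.id_comp _)

end AtiyahClass
end Sheaf
section Homological
open CategoryTheory Limits
universe v u w
variable {𝒜 : Type u} [Category.{v} 𝒜]

namespace AtiyahClass

section
variable [Preadditive 𝒜]

/-- The shifted complex `K[1]`, with `K[1]ⁿ = Kⁿ⁺¹` and the differential of `K`, without a sign. -/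
def shiftOne (K : CochainComplex 𝒜 ℤ) : CochainComplex 𝒜 ℤ where
  X n := K.X (n + 1)
  d i j := K.d (i + 1) (j + 1)
  shape i j h := K.shape _ _ (fun h' => h (by simp only [ComplexShape.up_Rel] at *; lia))

lemma isStrictlyGE_shiftOne {n : ℤ} (K : CochainComplex 𝒜 ℤ) [K.IsStrictlyGE n] :
    (shiftOne K).IsStrictlyGE (n - 1) := by
  rw [CochainComplex.isStrictlyGE_iff]
  intro i hi
  exact K.isZero_of_isStrictlyGE n (i + 1) (by lia)

variable [HasBinaryBiproducts 𝒜] {K L M : CochainComplex 𝒜 ℤ}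

/-- The differential `(x, y) ↦ (d x + (-1) ^ n • φ y, d y)` of the total complex. -/
def totD (φ : K ⟶ L) (n : ℤ) : L.X n ⊞ K.X (n + 1) ⟶ L.X (n + 1) ⊞ K.X (n + 1 + 1) :=
  biprod.desc (L.d n (n + 1) ≫ biprod.inl)
    (n.negOnePow • (φ.f (n + 1) ≫ biprod.inl) + K.d (n + 1) (n + 1 + 1) ≫ biprod.inr)

variable (φ : K ⟶ L)

/-- The total complex `Tot(φ : K ⟶ L)`, with `Totⁿ = Lⁿ ⊕ Kⁿ⁺¹` and differential
`(x, y) ↦ (d x + (-1) ^ n • φ y, d y)`. -/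
def tot : CochainComplex 𝒜 ℤ :=
  CochainComplex.of (fun n => L.X n ⊞ K.X (n + 1)) (totD φ)
    (fun n => by
      dsimp only [totD]
      ext <;> simp [Int.negOnePow_succ])

lemma tot_d (n : ℤ) : (tot φ).d n (n + 1) = totD φ n :=
  CochainComplex.of_d (fun n => L.X n ⊞ K.X (n + 1)) (totD φ) n

/-- The morphism `Tot(φ) ⟶ M`, `(x, y) ↦ g x`. -/
def totDesc (g : L ⟶ M) (h : φ ≫ g = 0) : tot φ ⟶ M where
  f n := (biprod.fst ≫ g.f n : L.X n ⊞ K.X (n + 1) ⟶ M.X n)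
  comm' i j hij := by
    obtain rfl : i + 1 = j := hij
    have h' : φ.f (i + 1) ≫ g.f (i + 1) = 0 := by
      rw [← HomologicalComplex.comp_f, h, HomologicalComplex.zero_f]
    have key : (biprod.fst ≫ g.f i : L.X i ⊞ K.X (i + 1) ⟶ _) ≫ M.d i (i + 1) =
        totD φ i ≫ biprod.fst ≫ g.f (i + 1) := by
      dsimp only [totD]
      ext <;> simp [h']
    exact key.trans (congrArg (· ≫ _) (tot_d φ i).symm)

/-- The morphism `Tot(φ) ⟶ K[1]`, `(x, y) ↦ y`. -/
def totSnd : tot φ ⟶ shiftOne K where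
  f n := (biprod.snd : L.X n ⊞ K.X (n + 1) ⟶ K.X (n + 1))
  comm' i j hij := by
    obtain rfl : i + 1 = j := hij
    have key : (biprod.snd : L.X i ⊞ K.X (i + 1) ⟶ _) ≫ K.d (i + 1) (i + 1 + 1) =
        totD φ i ≫ biprod.snd := by
      dsimp only [totD]
      ext <;> simp
    exact key.trans (congrArg (· ≫ _) (tot_d φ i).symm)

open CochainComplex

/-- The comparison of the mapping cone with `Tot(φ)`, in degree `n`. -/
def coneToTotX (n : ℤ) : (mappingCone φ).X n ⟶ L.X n ⊞ K.X (n + 1) :=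
  (mappingCone.snd φ).v n n (add_zero n) ≫ biprod.inl +
    n.negOnePow • ((mappingCone.fst φ).1.v n (n + 1) rfl ≫ biprod.inr)

/-- The inverse of the comparison, in degree `n`. -/
def totToConeX (n : ℤ) : L.X n ⊞ K.X (n + 1) ⟶ (mappingCone φ).X n :=
  biprod.desc ((mappingCone.inr φ).f n)
    (n.negOnePow • (mappingCone.inl φ).v (n + 1) n (by lia))

lemma coneToTotX_totToConeX (n : ℤ) : coneToTotX φ n ≫ totToConeX φ n = 𝟙 _ := by
  rw [← mappingCone.id_X φ n (n + 1) rfl]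
  simp [coneToTotX, totToConeX, smul_smul, add_comm]

lemma totToConeX_coneToTotX (n : ℤ) : totToConeX φ n ≫ coneToTotX φ n = 𝟙 _ := by
  ext <;> simp [coneToTotX, totToConeX, smul_smul]

lemma coneToTotX_totD (n : ℤ) :
    coneToTotX φ n ≫ totD φ n = (mappingCone φ).d n (n + 1) ≫ coneToTotX φ (n + 1) := by
  ext
  · simp [coneToTotX, totD, smul_smul, mappingCone.d_snd_v φ n (n + 1) rfl, add_comm]
  · simp [coneToTotX, totD, smul_smul, mappingCone.d_fst_v φ n (n + 1) (n + 1 + 1) rfl rfl,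
      Int.negOnePow_succ]

lemma coneToTotX_tot_d (n : ℤ) :
    (coneToTotX φ n : (mappingCone φ).X n ⟶ (tot φ).X n) ≫ (tot φ).d n (n + 1) =
      (mappingCone φ).d n (n + 1) ≫ coneToTotX φ (n + 1) := by
  rw [tot_d]
  exact coneToTotX_totD φ n

/-- The comparison of the mapping cone with `Tot(φ)`. -/
def coneToTot : mappingCone φ ⟶ tot φ where
  f := coneToTotX φ
  comm' i j h := by
    obtain rfl : i + 1 = j := h
    exact coneToTotX_tot_d φ i

instance (n : ℤ) : IsIso ((coneToTot φ).f n) :=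
  ⟨totToConeX φ n, coneToTotX_totToConeX φ n, totToConeX_coneToTotX φ n⟩

instance : IsIso (coneToTot φ) := HomologicalComplex.Hom.isIso_of_components _

lemma coneToTotX_fst (n : ℤ) :
    coneToTotX φ n ≫ biprod.fst = (mappingCone.snd φ).v n n (add_zero n) := by
  simp [coneToTotX]

lemma isStrictlyGE_tot {n : ℤ} [K.IsStrictlyGE n] [L.IsStrictlyGE n] :
    (tot φ).IsStrictlyGE (n - 1) := by
  rw [isStrictlyGE_iff]
  intro i hi
  exact (biprod_isZero_iff _ _).2 ⟨L.isZero_of_isStrictlyGE n i (by lia),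
    K.isZero_of_isStrictlyGE n (i + 1) (by lia)⟩

end

section
variable [Preadditive 𝒜] [HasBinaryBiproducts 𝒜]

/-- `K[1]`, for a bounded below complex `K`. -/
def shiftOnePlus (K : CochainComplex.Plus 𝒜) : CochainComplex.Plus 𝒜 :=
  ⟨shiftOne K.obj, by
    obtain ⟨n, hn⟩ := K.property
    exact ⟨n - 1, isStrictlyGE_shiftOne K.obj⟩⟩

/-- `Tot(φ)`, for a morphism `φ` of bounded below complexes. -/
def totPlus {K L : CochainComplex.Plus 𝒜} (φ : K ⟶ L) : CochainComplex.Plus 𝒜 :=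
  ⟨tot φ.hom, by
    obtain ⟨n, hn⟩ := K.property
    obtain ⟨m, hm⟩ := L.property
    have := K.obj.isStrictlyGE_of_ge (min n m) n (min_le_left _ _)
    have := L.obj.isStrictlyGE_of_ge (min n m) m (min_le_right _ _)
    exact ⟨min n m - 1, isStrictlyGE_tot φ.hom⟩⟩

end

section
variable [Abelian 𝒜]

open CochainComplex in
lemma coneToTot_totDesc (S : ShortComplex (CochainComplex 𝒜 ℤ)) :
    coneToTot S.f ≫ totDesc S.f S.g S.zero = mappingCone.descShortComplex S := by
  refine HomologicalComplex.hom_ext _ _ (fun n => ?_)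
  have key : (coneToTotX S.f n ≫ biprod.fst) ≫ S.g.f n =
      (mappingCone.descShortComplex S).f n := by
    rw [coneToTotX_fst]
    apply mappingCone.ext_from S.f (n + 1) n rfl
    · rw [mappingCone.inl_v_snd_v_assoc, mappingCone.inl_v_descShortComplex_f, zero_comp]
    · rw [mappingCone.inr_f_snd_v_assoc, mappingCone.inr_f_descShortComplex_f]
  exact (Category.assoc _ _ _).symm.trans key

lemma quasiIso_totDesc {S : ShortComplex (CochainComplex 𝒜 ℤ)} (hS : S.ShortExact) :
    QuasiIso (totDesc S.f S.g S.zero) := by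
  have := CochainComplex.mappingCone.quasiIso_descShortComplex hS
  have h : QuasiIso (coneToTot S.f ≫ totDesc S.f S.g S.zero) := by
    rw [coneToTot_totDesc]; exact this
  exact quasiIso_of_comp_left (coneToTot S.f) _

lemma isIso_plusQ [HasDerivedCategory.{w} 𝒜] {K L : CochainComplex.Plus 𝒜} (φ : K ⟶ L)
    (h : QuasiIso φ.hom) : IsIso (DerivedCategory.Plus.Q.map φ) := by
  have h1 : IsIso (DerivedCategory.Q.map φ.hom) := inferInstance
  have h2 : IsIso (DerivedCategory.Qh.map ((HomotopyCategory.quotient _ _).map φ.hom)) :=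
    ((MorphismProperty.isomorphisms _).arrow_mk_iso_iff
      ((Functor.mapArrowFunctor _ _).mapIso (DerivedCategory.quotientCompQhIso 𝒜) |>.app
        (Arrow.mk φ.hom))).2 h1
  have h3 : IsIso (DerivedCategory.Plus.ι.map (DerivedCategory.Plus.Q.map φ)) := h2
  exact isIso_of_fully_faithful DerivedCategory.Plus.ι _

end

end AtiyahClass
end Homological
section Main
open CategoryTheory AlgebraicGeometry TopologicalSpace
universe w u

namespace AtiyahClass

/-- A vector bundle: an `𝒪_X`-module which is locally free of finite rank. -/
def IsVectorBundle {X : Scheme.{u}} (E : X.Modules) : Prop :=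
  ∀ x : X, ∃ U : X.Opens, x ∈ U ∧ ∃ n : ℕ,
    Nonempty (E.restrict U.ι ≅
      (SheafOfModules.free (ULift.{u} (Fin n)) : U.toScheme.Modules))

variable {k : Type u} [CommRing k] {X : Scheme.{u}} (f : X ⟶ Spec (CommRingCat.of k))

/-- The local section `e ⊗ dr` of `E ⊗ Ω_{X/k}`. -/
def tmulD {E : X.Modules} {U : X.Opens} (e : Γ(E, U)) (r : Γ(X, U)) : Γ((twist f).obj E, U) :=
  (((adj X).unit.app ((PresheafJet.twist (scalars f)).obj ((forget X).obj E))).app (.op U)).hom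
    (PresheafJet.tmulD (φ := scalars f) (M := (forget X).obj E) (U := .op U) e r)

/-- A connection on `E` relative to `k`: a `k`-linear morphism of sheaves `∇ : E ⟶ E ⊗ Ω_{X/k}`
such that `∇ (r • e) = r • ∇ e + e ⊗ dr` for all local sections `r` of `𝒪_X` and `e` of `E`. -/
structure Connection (E : X.Modules) where
  app (U : X.Opens) : Γ(E, U) →+ Γ((twist f).obj E, U)
  naturality {U V : X.Opens} (i : U ⟶ V) (e : Γ(E, V)) :
    app U (E.presheaf.map i.op e) = ((twist f).obj E).presheaf.map i.op (app V e)
  scalar_smul {U : X.Opens} (c : k) (e : Γ(E, U)) :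
    app U ((scalars f).app (.op U) c • e) = (scalars f).app (.op U) c • app U e
  leibniz {U : X.Opens} (r : Γ(X, U)) (e : Γ(E, U)) :
    app U (r • e) = r • app U e + tmulD f e r

variable (E : CochainComplex.Plus X.Modules)

/-- The complex `E ⊗ Ω_{X/k}`, with differential `d ⊗ 1`. -/
def twistPlus : CochainComplex.Plus X.Modules := (twist f).mapCochainComplexPlus.obj E

/-- The complex `J₁(E)`. -/
def jetPlus : CochainComplex.Plus X.Modules := (jet f).mapCochainComplexPlus.obj E

/-- The inclusion of complexes `E ⊗ Ω_{X/k} ⟶ J₁(E)`. -/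
def inclPlus : twistPlus f E ⟶ jetPlus f E :=
  ObjectProperty.homMk
    { f := fun n => (incl f).app (E.obj.X n)
      comm' := fun i j _ => ((incl f).naturality (E.obj.d i j)).symm }

/-- The projection of complexes `J₁(E) ⟶ E`. -/
def projPlus : jetPlus f E ⟶ E :=
  ObjectProperty.homMk
    { f := fun n => (proj f).app (E.obj.X n)
      comm' := fun i j _ => ((proj f).naturality (E.obj.d i j)).symm }

lemma inclPlus_projPlus : (inclPlus f E).hom ≫ (projPlus f E).hom = 0 :=
  HomologicalComplex.hom_ext _ _ (fun n => incl_comp_proj f (E.obj.X n))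

lemma shortExact_plus : (ShortComplex.mk (inclPlus f E).hom (projPlus f E).hom
    (inclPlus_projPlus f E)).ShortExact :=
  HomologicalComplex.shortExact_of_degreewise_shortExact _ (fun n => shortExact f (E.obj.X n))

/-- The quasi-isomorphism `Tot(E ⊗ Ω ⟶ J₁(E)) ⟶ E` given by `(x, y) ↦ g x`. -/
def totDescPlus : totPlus (inclPlus f E) ⟶ E :=
  ObjectProperty.homMk (totDesc (inclPlus f E).hom (projPlus f E).hom (inclPlus_projPlus f E))

/-- The projection `Tot(E ⊗ Ω ⟶ J₁(E)) ⟶ (E ⊗ Ω)[1]` given by `(x, y) ↦ y`. -/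
def totSndPlus : totPlus (inclPlus f E) ⟶ shiftOnePlus (twistPlus f E) :=
  ObjectProperty.homMk (totSnd (inclPlus f E).hom)

variable [HasDerivedCategory.{w} X.Modules]

instance : IsIso (DerivedCategory.Plus.Q.map (totDescPlus f E)) :=
  isIso_plusQ _ (quasiIso_totDesc (shortExact_plus f E))

/-- The Atiyah class of `E` in `Hom_{D⁺}(E, (E ⊗ Ω)[1])`: the connecting morphism
`E ← Tot(E ⊗ Ω ⟶ J₁(E)) → (E ⊗ Ω)[1]` of the exact sequence of complexes
`0 ⟶ E ⊗ Ω ⟶ J₁(E) ⟶ E ⟶ 0`. -/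
def atiyahClass :
    DerivedCategory.Plus.Q.obj E ⟶ DerivedCategory.Plus.Q.obj (shiftOnePlus (twistPlus f E)) :=
  inv (DerivedCategory.Plus.Q.map (totDescPlus f E)) ≫
    DerivedCategory.Plus.Q.map (totSndPlus f E)

end AtiyahClass
end Main
end

open CategoryTheory AlgebraicGeometry AtiyahClass
universe w u

/-!
A connection `∇` on `E` is the same datum as an `𝒪_X`-linear section `e ↦ j e - ∇ e` of
`J₁(E) ⟶ E`, where `j` is the universal first order operator: the Leibniz rule for `∇` matches
`j (r e) = r j e + e ⊗ dr`. Connections on the terms of a complex therefore split the sequence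
`0 ⟶ E ⊗ Ω ⟶ J₁(E) ⟶ E ⟶ 0` degreewise, though the sections `s` and retractions `r` need not
commute with the differentials. For any degreewise split sequence, `r d s` is a cocycle and
`x ↦ (s x, -(-1)ⁿ r d s x)` is a morphism of complexes splitting `Tot ⟶ E`, so that the connecting
morphism is represented by `-(-1)ⁿ r d s`. Since the retraction satisfies `r (j e) = ∇ e`, for the
splittings above `r d s = ∇ d - (d ⊗ 1) ∇`.
-/

noncomputable section

namespace AtiyahClass

section DegreewiseSplit
open Limits CochainComplex HomComplex
universe v
variable {𝒜 : Type u} [Category.{v} 𝒜]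

section Preadditive
variable [Preadditive 𝒜]

/-- The morphism `K ⟶ L[1]`, `x ↦ (-1)ⁿ z x`, attached to a `1`-cocycle `z`. The sign turns the
cocycle condition `d z + z d = 0` into compatibility with the unsigned differential of `L[1]`. -/
def homOfCocycle {K L : CochainComplex 𝒜 ℤ} (z : Cocycle K L 1) : K ⟶ shiftOne L where
  f n := n.negOnePow • z.1.v n (n + 1) rfl
  comm' := by
    rintro n _ rfl
    have hz : z.1.v n (n + 1) rfl ≫ L.d (n + 1) (n + 1 + 1) =
        -(K.d n (n + 1) ≫ z.1.v (n + 1) (n + 1 + 1) rfl) := by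
      have h := Cochain.congr_v (z.δ_eq_zero 2) n (n + 1 + 1) (by lia)
      rw [δ_v 1 2 rfl _ _ _ _ (n + 1) (n + 1) (by lia) rfl] at h
      simpa [Int.negOnePow_even 2 even_two, add_eq_zero_iff_eq_neg] using h
    change (n.negOnePow • z.1.v n (n + 1) rfl) ≫ L.d (n + 1) (n + 1 + 1) =
      K.d n (n + 1) ≫ ((n + 1).negOnePow • z.1.v (n + 1) (n + 1 + 1) rfl)
    simp [hz, Int.negOnePow_succ]

variable (S : ShortComplex (CochainComplex 𝒜 ℤ))

/-- The sequence of terms in degree `n` of a short complex of cochain complexes. It is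
`S.map (HomologicalComplex.eval ..)`, with its objects in the form `S.Xᵢ.X n`. -/
abbrev degreeShortComplex (n : ℤ) : ShortComplex 𝒜 :=
  .mk (S.f.f n) (S.g.f n) (by rw [← HomologicalComplex.comp_f, S.zero, HomologicalComplex.zero_f])

variable (σ : ∀ n, (degreeShortComplex S n).Splitting)

/-- The cocycle `r d s` attached to degreewise sections `s` and retractions `r`. -/
def splittingCocycle : Cocycle S.X₃ S.X₁ 1 := cocycleOfDegreewiseSplit S σ

lemma splittingCocycle_v (n : ℤ) :
    (splittingCocycle S σ).1.v n (n + 1) rfl = (σ n).s ≫ S.X₂.d n (n + 1) ≫ (σ (n + 1)).r :=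
  rfl

lemma δ_ofHoms_s :
    δ 0 1 (Cochain.ofHoms fun n => (σ n).s) =
      (splittingCocycle S σ).1.comp (Cochain.ofHom S.f) (add_zero 1) := by
  ext n _ rfl
  have r_f := (σ (n + 1)).r_f
  have s_g := (σ n).s_g
  dsimp only at r_f s_g
  rw [δ_v 0 1 rfl _ n (n + 1) rfl n (n + 1) (by lia) rfl, Cochain.comp_zero_cochain_v,
    splittingCocycle_v, Cochain.ofHom_v, Category.assoc, Category.assoc, r_f,
    Preadditive.comp_sub, Preadditive.comp_sub, ← S.g.comm_assoc, reassoc_of% s_g]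
  simp [sub_eq_add_neg]

variable [HasBinaryBiproducts 𝒜]

lemma coneToTotX_snd {K L : CochainComplex 𝒜 ℤ} (φ : K ⟶ L) (n : ℤ) :
    coneToTotX φ n ≫ biprod.snd = n.negOnePow • (mappingCone.fst φ).1.v n (n + 1) rfl := by
  simp [coneToTotX]

/-- The section `x ↦ (s x, -(-1)ⁿ r d s x)` of `Tot(S.f) ⟶ S.X₃` attached to degreewise sections
`s` and retractions `r`. -/
def totSection : S.X₃ ⟶ tot S.f :=
  mappingCone.lift S.f (-splittingCocycle S σ) (Cochain.ofHoms fun n => (σ n).s)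
    (by simp [δ_ofHoms_s]) ≫ coneToTot S.f

lemma totSection_comp_totSnd :
    totSection S σ ≫ totSnd S.f = homOfCocycle (-splittingCocycle S σ) := by
  rw [totSection, Category.assoc]
  ext n
  change (mappingCone.lift S.f _ _ _).f n ≫ coneToTotX S.f n ≫ biprod.snd =
    n.negOnePow • (-splittingCocycle S σ).1.v n (n + 1) rfl
  rw [coneToTotX_snd, Linear.comp_units_smul, mappingCone.lift_f_fst_v]

end Preadditive

lemma totSection_comp_totDesc [Abelian 𝒜] (S : ShortComplex (CochainComplex 𝒜 ℤ))
    (σ : ∀ n, (degreeShortComplex S n).Splitting) :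
    totSection S σ ≫ totDesc S.f S.g S.zero = 𝟙 S.X₃ := by
  rw [totSection, Category.assoc, coneToTot_totDesc]
  ext n
  simpa [mappingCone.lift_f _ _ _ _ n (n + 1) rfl] using (σ n).s_g

end DegreewiseSplit
end AtiyahClass

namespace PresheafJet
universe v
variable {C : Type w} [Category.{v} C] {A : CommRingCat.{u}} {R : Cᵒᵖ ⥤ CommRingCat.{u}}
  (φ : (Functor.const Cᵒᵖ).obj A ⟶ R)
  {M N : PresheafOfModules.{u} (R ⋙ forget₂ CommRingCat RingCat)}

lemma inclEv_tmulD (U : Cᵒᵖ) (m : sec M U) (r : R.obj U) :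
    inclEv φ M U (tmulD m r) = prolong φ M U (r • m) - r • prolong φ M U m :=
  letI := algebra φ U
  Jet.incl_tmul_D A (R.obj U) (sec M U) m r

lemma jetEv_prolong (f : M ⟶ N) (U : Cᵒᵖ) (m : sec M U) :
    jetEv φ f U (prolong φ M U m) = prolong φ N U (ev f U m) :=
  letI := algebra φ U
  Jet.map_prolong (AlgHom.id A (R.obj U)) (ev f U).toAddMonoidHom (ev f U).map_smul m

end PresheafJet

namespace AtiyahClass
variable {k : Type u} [CommRing k] {X : Scheme.{u}} (f : X ⟶ Spec (CommRingCat.of k))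

/-- The map from sections of a presheaf of modules to sections of the associated sheaf. -/
def toSheafify (P : PMod X) (U : X.Opens) :
    PresheafJet.sec P (.op U) →ₗ[Γ(X, U)] Γ((sheafify X).obj P, U) :=
  (((adj X).unit.app P).app (.op U)).hom

lemma sheafify_map_toSheafify {P Q : PMod X} (g : P ⟶ Q) (U : X.Opens)
    (x : PresheafJet.sec P (.op U)) :
    ((sheafify X).map g).app U (toSheafify P U x) = toSheafify Q U (PresheafJet.ev g (.op U) x) :=
  congrArg (fun h => (PresheafOfModules.Hom.app h (.op U)).hom x) ((adj X).unit.naturality g).symm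

lemma toSheafify_res (P : PMod X) {U V : X.Opens} (i : U ⟶ V) (x : PresheafJet.sec P (.op V)) :
    toSheafify P U (PresheafJet.res P i.op x) =
      ((sheafify X).obj P).presheaf.map i.op (toSheafify P V x) :=
  congrArg (fun h => h.hom x) (((adj X).unit.app P).naturality i.op)

lemma counit_toSheafify (E : X.Modules) (U : X.Opens) (e : Γ(E, U)) :
    ((adj X).counit.app E).app U (toSheafify ((forget X).obj E) U e) = e :=
  congrArg (fun h => (PresheafOfModules.Hom.app h (.op U)).hom e)
    ((adj X).right_triangle_components E)

/-- The universal first order differential operator `j : E ⟶ J₁(E)`, `e ↦ [1 ⊗ 1] ⊗ e`, on local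
sections. -/
def prolong (E : X.Modules) (U : X.Opens) : Γ(E, U) →+ Γ((jet f).obj E, U) :=
  (toSheafify ((PresheafJet.jet (scalars f)).obj ((forget X).obj E)) U).toAddMonoidHom.comp
    (PresheafJet.prolong (scalars f) ((forget X).obj E) (.op U))

lemma prolong_res (E : X.Modules) {U V : X.Opens} (i : U ⟶ V) (e : Γ(E, V)) :
    prolong f E U (E.presheaf.map i.op e) = ((jet f).obj E).presheaf.map i.op (prolong f E V e) :=
  (congrArg (toSheafify _ U) (PresheafJet.prolong_res (scalars f) i.op e)).trans
    (toSheafify_res _ i _)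

lemma jet_map_prolong {E F : X.Modules} (g : E ⟶ F) (U : X.Opens) (e : Γ(E, U)) :
    ((jet f).map g).app U (prolong f E U e) = prolong f F U (g.app U e) :=
  (sheafify_map_toSheafify _ U _).trans
    (congrArg (toSheafify _ U) (PresheafJet.jetEv_prolong (scalars f) ((forget X).map g) (.op U) e))

lemma proj_prolong (E : X.Modules) (U : X.Opens) (e : Γ(E, U)) :
    ((proj f).app E).app U (prolong f E U e) = e := by
  have h : ((sheafify X).map ((PresheafJet.proj (scalars f)).app ((forget X).obj E))).app U
      (prolong f E U e) = toSheafify ((forget X).obj E) U e :=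
    (sheafify_map_toSheafify _ U _).trans
      (congrArg (toSheafify _ U) (PresheafJet.projEv_prolong (scalars f) (.op U) e))
  exact (congrArg (((adj X).counit.app E).app U) h).trans (counit_toSheafify E U e)

lemma incl_tmulD (E : X.Modules) (U : X.Opens) (e : Γ(E, U)) (r : Γ(X, U)) :
    ((incl f).app E).app U (tmulD f e r) = prolong f E U (r • e) - r • prolong f E U e := by
  let P := (PresheafJet.jet (scalars f)).obj ((forget X).obj E)
  have h : toSheafify P U (PresheafJet.inclEv (scalars f) ((forget X).obj E) (.op U)
      (PresheafJet.tmulD e r)) = prolong f E U (r • e) - r • prolong f E U e :=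
    (congrArg (toSheafify P U) (PresheafJet.inclEv_tmulD (scalars f) (.op U) e r)).trans
      ((map_sub (toSheafify P U) _ _).trans
        (congrArg (_ - ·) ((toSheafify P U).map_smul r _)))
  exact (sheafify_map_toSheafify _ U _).trans h

lemma hom_app_res {E F : X.Modules} (g : E ⟶ F) {U V : X.Opens} (i : U ⟶ V) (e : Γ(E, V)) :
    g.app U (E.presheaf.map i.op e) = F.presheaf.map i.op (g.app V e) :=
  congrArg (fun h => h.hom e) (g.mapPresheaf.naturality i.op)

lemma app_app_of_comp_eq {E F G : X.Modules} {g : E ⟶ F} {h : F ⟶ G} {l : E ⟶ G} (w : g ≫ h = l)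
    (U : X.Opens) (e : Γ(E, U)) : h.app U (g.app U e) = l.app U e := by
  subst w
  rfl

lemma units_smul_app {E F : X.Modules} (u : ℤˣ) (g : E ⟶ F) (U : X.Opens) (e : Γ(E, U)) :
    (u • g).app U e = u • g.app U e := by
  rcases Int.units_eq_one_or u with rfl | rfl
  · rw [one_smul, one_smul]
  · rw [Units.neg_smul, Units.neg_smul, one_smul, one_smul]
    rfl

/-- The morphism of `𝒪_X`-modules given by compatible linear maps on sections. -/
def homOfLinearMaps {E F : X.Modules} (g : ∀ U : X.Opens, Γ(E, U) →ₗ[Γ(X, U)] Γ(F, U))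
    (hg : ∀ {U V : X.Opens} (i : U ⟶ V) (e : Γ(E, V)),
      g U (E.presheaf.map i.op e) = F.presheaf.map i.op (g V e)) : E ⟶ F :=
  ⟨PresheafOfModules.homMk (M₁ := E.val) (M₂ := F.val)
    { app U := AddCommGrpCat.ofHom (g U.unop).toAddMonoidHom
      naturality _ _ i := by ext e; exact hg i.unop e }
    fun U => (g U.unop).map_smul⟩

/-- The short exact sequence `0 ⟶ E ⊗ Ω ⟶ J₁(E) ⟶ E ⟶ 0`. -/
abbrev jetSequence (E : X.Modules) : ShortComplex X.Modules :=
  .mk ((incl f).app E) ((proj f).app E) (incl_comp_proj f E)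

variable {f} in
lemma splitting_r_app_incl_app {E : X.Modules} (σ : (jetSequence f E).Splitting) (U : X.Opens)
    (y : Γ((twist f).obj E, U)) : σ.r.app U (((incl f).app E).app U y) = y :=
  app_app_of_comp_eq σ.f_r U y

end AtiyahClass

namespace AtiyahClass.Connection
variable {k : Type u} [CommRing k] {X : Scheme.{u}} {f : X ⟶ Spec (CommRingCat.of k)}
  {E F : X.Modules} (D : Connection f E) (D' : Connection f F)

/-- The `𝒪_X`-linear section `e ↦ j e - ∇ e` of `J₁(E) ⟶ E` defined by a connection `∇`. -/
def jetSection : E ⟶ (jet f).obj E :=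
  homOfLinearMaps
    (fun U =>
      { toFun e := prolong f E U e - ((incl f).app E).app U (D.app U e)
        map_add' e e' := by simp only [map_add]; abel
        map_smul' r e := by
          rw [D.leibniz, map_add, Scheme.Modules.Hom.app_smul, incl_tmulD, RingHom.id_apply,
            smul_sub]
          abel })
    (fun {U V} i e => by
      change prolong f E U _ - ((incl f).app E).app U (D.app U _) =
        ((jet f).obj E).presheaf.map i.op (prolong f E V e - ((incl f).app E).app V (D.app V e))
      rw [prolong_res, D.naturality, hom_app_res, map_sub])

lemma jetSection_app (U : X.Opens) (e : Γ(E, U)) :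
    D.jetSection.app U e = prolong f E U e - ((incl f).app E).app U (D.app U e) :=
  rfl

lemma jetSection_proj : D.jetSection ≫ (proj f).app E = 𝟙 E := by
  ext U e
  have h : ((proj f).app E).app U (((incl f).app E).app U (D.app U e)) = 0 :=
    app_app_of_comp_eq (incl_comp_proj f E) U (D.app U e)
  change ((proj f).app E).app U (D.jetSection.app U e) = e
  rw [jetSection_app, map_sub, proj_prolong, h, sub_zero]

/-- The splitting of the jet sequence of `E` defined by a connection on `E`. -/
def splitting : (jetSequence f E).Splitting :=
  .ofExactOfSection _ (shortExact f E).exact D.jetSection D.jetSection_proj (shortExact f E).mono_f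

lemma splitting_r_app_prolong (U : X.Opens) (e : Γ(E, U)) :
    D.splitting.r.app U (prolong f E U e) = D.app U e := by
  have hs : D.splitting.r.app U (D.jetSection.app U e) = 0 :=
    app_app_of_comp_eq D.splitting.s_r U e
  rw [jetSection_app, map_sub, splitting_r_app_incl_app] at hs
  exact sub_eq_zero.1 hs

lemma splitting_s_comp_jet_map_comp_r_app (d : E ⟶ F) (U : X.Opens) (e : Γ(E, U)) :
    (D.splitting.s ≫ (jet f).map d ≫ D'.splitting.r).app U e =
      D'.app U (d.app U e) - ((twist f).map d).app U (D.app U e) := by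
  have hd : ((jet f).map d).app U (((incl f).app E).app U (D.app U e)) =
      ((incl f).app F).app U (((twist f).map d).app U (D.app U e)) :=
    app_app_of_comp_eq ((incl f).naturality d).symm U (D.app U e)
  change D'.splitting.r.app U (((jet f).map d).app U (D.jetSection.app U e)) = _
  rw [jetSection_app, map_sub, map_sub, jet_map_prolong, splitting_r_app_prolong, hd,
    splitting_r_app_incl_app]

end AtiyahClass.Connection

namespace AtiyahClass
variable {k : Type u} [CommRing k] {X : Scheme.{u}} (f : X ⟶ Spec (CommRingCat.of k))
  (E : CochainComplex.Plus X.Modules)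

/-- The short exact sequence of complexes `0 ⟶ E ⊗ Ω ⟶ J₁(E) ⟶ E ⟶ 0`. -/
abbrev jetSequencePlus : ShortComplex (CochainComplex X.Modules ℤ) :=
  .mk (inclPlus f E).hom (projPlus f E).hom (inclPlus_projPlus f E)

lemma atiyahClass_eq_map_of_section [HasDerivedCategory.{w} X.Modules]
    {s : E ⟶ totPlus (inclPlus f E)} (hs : s ≫ totDescPlus f E = 𝟙 E) :
    atiyahClass f E = DerivedCategory.Plus.Q.map (s ≫ totSndPlus f E) := by
  have hQ : DerivedCategory.Plus.Q.map s ≫ DerivedCategory.Plus.Q.map (totDescPlus f E) = 𝟙 _ := by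
    rw [← Functor.map_comp, hs, CategoryTheory.Functor.map_id]
  rw [atiyahClass, Functor.map_comp, IsIso.inv_eq_of_inv_hom_id hQ]

lemma atiyahClass_eq_map_of_splitting [HasDerivedCategory.{w} X.Modules]
    (σ : ∀ n : ℤ, (jetSequence f (E.obj.X n)).Splitting) :
    atiyahClass f E = DerivedCategory.Plus.Q.map (ObjectProperty.homMk
      (homOfCocycle (-splittingCocycle (jetSequencePlus f E) σ)) :
        E ⟶ shiftOnePlus (twistPlus f E)) := by
  let s : E ⟶ totPlus (inclPlus f E) :=
    ObjectProperty.homMk (totSection (jetSequencePlus f E) σ)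
  have hs : s ≫ totDescPlus f E = 𝟙 E :=
    ObjectProperty.hom_ext _ (totSection_comp_totDesc (jetSequencePlus f E) σ)
  rw [atiyahClass_eq_map_of_section f E hs]
  exact congrArg _ (ObjectProperty.hom_ext _ (totSection_comp_totSnd (jetSequencePlus f E) σ))

variable {f}

/-- The morphism of complexes `θₙ = (-1)ⁿ (-∇ d + (d ⊗ 1) ∇)`. -/
def theta (nabla : ∀ n : ℤ, Connection f (E.obj.X n)) : E ⟶ shiftOnePlus (twistPlus f E) :=
  ObjectProperty.homMk (homOfCocycle
    (-splittingCocycle (jetSequencePlus f E) fun n => (nabla n).splitting))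

lemma theta_f_app (nabla : ∀ n : ℤ, Connection f (E.obj.X n)) (n : ℤ) (U : X.Opens)
    (e : Γ(E.obj.X n, U)) :
    Scheme.Modules.Hom.app ((theta E nabla).hom.f n) U e =
      n.negOnePow • (-(nabla (n + 1)).app U ((E.obj.d n (n + 1)).app U e) +
        ((twist f).map (E.obj.d n (n + 1))).app U ((nabla n).app U e)) := by
  rw [neg_add_eq_sub, ← neg_sub,
    ← (nabla n).splitting_s_comp_jet_map_comp_r_app (nabla (n + 1)) (E.obj.d n (n + 1)) U e]
  exact units_smul_app n.negOnePow (-((nabla n).splitting.s ≫ (jet f).map (E.obj.d n (n + 1)) ≫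
    (nabla (n + 1)).splitting.r)) U e

end AtiyahClass

theorem proposition6_general {k : Type u} [CommRing k] {X : Scheme.{u}}
    (f : X ⟶ Spec (CommRingCat.of k)) [HasDerivedCategory.{w} X.Modules]
    (E : CochainComplex.Plus X.Modules) (nabla : ∀ n : ℤ, Connection f (E.obj.X n)) :
    ∃ θ : E ⟶ shiftOnePlus (twistPlus f E),
      (∀ (n : ℤ) (U : X.Opens) (e : Γ(E.obj.X n, U)),
        Scheme.Modules.Hom.app (θ.hom.f n) U e =
          n.negOnePow • (-(nabla (n + 1)).app U ((E.obj.d n (n + 1)).app U e) +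
            ((twist f).map (E.obj.d n (n + 1))).app U ((nabla n).app U e))) ∧
      atiyahClass f E = DerivedCategory.Plus.Q.map θ :=
  ⟨theta E nabla, theta_f_app E nabla,
    atiyahClass_eq_map_of_splitting f E fun n => (nabla n).splitting⟩

end

theorem proposition6 {k : Type u} [Field k] [CharZero k] {X : Scheme.{u}}
    (f : X ⟶ Spec (CommRingCat.of k)) [Smooth f] [HasDerivedCategory.{w} X.Modules]
    (E : CochainComplex.Plus X.Modules) (hE : ∀ n : ℤ, IsVectorBundle (E.obj.X n))
    (nabla : ∀ n : ℤ, Connection f (E.obj.X n)) :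
    ∃ θ : E ⟶ shiftOnePlus (twistPlus f E),
      (∀ (n : ℤ) (U : X.Opens) (e : Γ(E.obj.X n, U)),
        Scheme.Modules.Hom.app (θ.hom.f n) U e =
          n.negOnePow • (-(nabla (n + 1)).app U ((E.obj.d n (n + 1)).app U e) +
            ((twist f).map (E.obj.d n (n + 1))).app U ((nabla n).app U e))) ∧
      atiyahClass f E = DerivedCategory.Plus.Q.map θ :=
  proposition6_general f E nabla
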